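/- Let $R$ be an integral domain with quotient field $K\neq R$. For an integral domain $A$ with quotient field $K$, $A\ne K$, and nonzero fractional ideals $I,J$ of $A$ put $(J:I)=\{x\in K: xI\subseteq J\}$, $I_v=(A:(A:I))$, $I_t=\bigcup\{J_v : J\subseteq I,\ J \text{ a nonzero finitely generated fractional ideal}\}$, and $I_w=\bigcap_{M\in t\text{-}\mathrm{Max}(A)} IA_M$; a nonzero fractional ideal $I$ is divisorial (resp. a $t$-ideal, a $w$-ideal) if $I=I_v$ (resp. $I=I_t$, $I=I_w$). Here $t\text{-}\mathrm{Max}(A)$ is the set of $t$-maximal ideals, i.e. ideals maximal among the proper integral $t$-ideals of $A$ (they are prime), and a $t$-prime is a (nonzero) prime ideal that is a $t$-ideal. The domain $A$ is - divisorial if every nonzero fractional ideal is divisorial; - $w$-divisorial if every $w$-ideal is divisorial; - strongly $w$-divisorial if it is $w$-divisorial and $A_P$ is a divisorial domain for every $t$-prime $P$ of $A$; - a $TV$-domain if every $t$-ideal is divisorial; - weakly Matlis if $t\text{-}\mathrm{Max}(A)$ is independent of finite character. A family of nonzero prime ideals is of finite character if each nonzero element of the domain lies in at most finitely many of its members, and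 independent if no two distinct members contain a common nonzero prime ideal. An overring $T$ of $R$ (a ring $R\subseteq T\subseteq K$) is $t$-flat over $R$ if $T_M=R_{M\cap R}$ for every $t$-maximal ideal $M$ of $T$. Theorem. Let $R$ be strongly $w$-divisorial and let $\Lambda$ be a nonempty set of pairwise incomparable $t$-primes of $R$. Let $\mathcal F(\Lambda)$ be the set of all ideals $J$ of $R$ with $J\not\subseteq P$ for each $P\in\Lambda$, and let $R_{\mathcal F(\Lambda)}=\bigcup\{(R:J): J\in\mathcal F(\Lambda)\}$ $(=\bigcap_{P\in\Lambda}R_P)$. The following conditions are equivalent: 1. $R_{\mathcal F(\Lambda)}$ is $w$-divisorial; 2. $R_{\mathcal F(\Lambda)}$ is strongly $w$-divisorial; 3. $R_{\mathcal F(\Lambda)}$ is $t$-flat over $R$ and weakly Matlis; 4. $R_{\mathcal F(\Lambda)}$ is $t$-flat over $R$ and a $TV$-domain; 5. $\Lambda$ is independent of finite character. -/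

import Mathlib

/-!
Star operations on an integral domain `A` with quotient field `K`. All fractional ideals,
localizations and overrings are taken inside `K`. A prime ideal is an element of
`PrimeSpectrum A`, and a family of prime ideals is a `Set (PrimeSpectrum A)`.
-/

noncomputable section

namespace WDiv

open scoped nonZeroDivisors

section Closures

variable {A K : Type*} [CommRing A] [Field K] [Algebra A K]

/-- The `v`-closure `(A : (A : I))`; here `1` is `A` as an `A`-submodule of `K` and
`J / I = {x ∈ K | x I ⊆ J}`. -/
def vClosure (I : Submodule A K) : Submodule A K := 1 / (1 / I)

theorem div_anti {I J : Submodule A K} (h : I ≤ J) (L : Submodule A K) : L / J ≤ L / I :=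
  fun _ hx => Submodule.mem_div_iff_forall_mul_mem.2 fun y hy =>
    Submodule.mem_div_iff_forall_mul_mem.1 hx y (h hy)

theorem vClosure_mono {I J : Submodule A K} (h : I ≤ J) : vClosure I ≤ vClosure J :=
  div_anti (div_anti h 1) 1

/-- The `t`-closure: the union of the `J_v`, for `J` a finitely generated submodule of `I`. -/
def tClosure (I : Submodule A K) : Submodule A K where
  carrier := {x | ∃ J : Submodule A K, J.FG ∧ J ≤ I ∧ x ∈ vClosure J}
  zero_mem' := ⟨⊥, Submodule.fg_bot, bot_le, Submodule.zero_mem _⟩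
  add_mem' := by
    rintro x y ⟨J, hJ, hJI, hx⟩ ⟨L, hL, hLI, hy⟩
    exact ⟨J ⊔ L, hJ.sup hL, sup_le hJI hLI, Submodule.add_mem _
      (vClosure_mono le_sup_left hx) (vClosure_mono le_sup_right hy)⟩
  smul_mem' := by
    rintro a x ⟨J, hJ, hJI, hx⟩
    exact ⟨J, hJ, hJI, Submodule.smul_mem _ a hx⟩

end Closures

section Domains

variable (A K : Type*) [CommRing A] [IsDomain A] [Field K] [Algebra A K] [IsFractionRing A K]

variable {A} in
/-- A nonzero fractional ideal `I` is divisorial if `I_v = I`. -/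
def IsDivisorial (I : FractionalIdeal A⁰ K) : Prop :=
  I ≠ 0 ∧ vClosure (I : Submodule A K) = I

variable {A} in
/-- A nonzero fractional ideal `I` is a `t`-ideal if `I_t = I`. -/
def IsTIdeal (I : FractionalIdeal A⁰ K) : Prop :=
  I ≠ 0 ∧ tClosure (I : Submodule A K) = I

/-- The set of `t`-prime ideals. -/
def tSpec : Set (PrimeSpectrum A) :=
  {P | IsTIdeal K (P.asIdeal : FractionalIdeal A⁰ K)}

/-- The set of `t`-maximal ideals, i.e. ideals that are maximal in the set of all proper
(integral) `t`-ideals. Such ideals are always prime. -/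
def tMax : Set (PrimeSpectrum A) :=
  {P | Maximal (fun I : Ideal A => I ≠ ⊤ ∧ IsTIdeal K (I : FractionalIdeal A⁰ K)) P.asIdeal}

variable {A} in
/-- The localization `A_P`, as a subring of `K` containing `A`. -/
def locAt (P : PrimeSpectrum A) : Subalgebra A K :=
  Localization.subalgebra.ofField K P.asIdeal.primeCompl
    P.asIdeal.primeCompl_le_nonZeroDivisors

variable {A K} in
/-- The `w`-closure: the intersection of the `I A_M`, for `M` a `t`-maximal ideal. -/
def wClosure (I : Submodule A K) : Submodule A K :=
  ⨅ M ∈ tMax A K, I * Subalgebra.toSubmodule (locAt K M)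

variable {A} in
/-- A nonzero fractional ideal `I` is a `w`-ideal if `I_w = I`. -/
def IsWIdeal (I : FractionalIdeal A⁰ K) : Prop :=
  I ≠ 0 ∧ wClosure (I : Submodule A K) = I

/-- Every nonzero fractional ideal is divisorial. -/
def IsDivisorialDomain : Prop :=
  ∀ I : FractionalIdeal A⁰ K, I ≠ 0 → IsDivisorial K I

/-- Every `w`-ideal is divisorial. -/
def IsWDivisorial : Prop :=
  ∀ I : FractionalIdeal A⁰ K, IsWIdeal K I → IsDivisorial K I

/-- `A` is `w`-divisorial and `A_P` is a divisorial domain for every `t`-prime ideal `P`. -/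
def IsStronglyWDivisorial : Prop :=
  IsWDivisorial A K ∧ ∀ P ∈ tSpec A K, IsDivisorialDomain (locAt K P) K

/-- Every `t`-ideal is divisorial. -/
def IsTVDomain : Prop :=
  ∀ I : FractionalIdeal A⁰ K, IsTIdeal K I → IsDivisorial K I

variable {A} in
/-- Every nonzero element belongs to at most finitely many members of the family. -/
def FiniteCharacter (Λ : Set (PrimeSpectrum A)) : Prop :=
  ∀ x : A, x ≠ 0 → {P ∈ Λ | x ∈ P.asIdeal}.Finite

variable {A} in
/-- No two distinct members of the family contain a common nonzero prime ideal. -/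
def Independent (Λ : Set (PrimeSpectrum A)) : Prop :=
  Λ.Pairwise fun P Q => ¬ ∃ N : PrimeSpectrum A,
    N.asIdeal ≠ ⊥ ∧ N.asIdeal ≤ P.asIdeal ∧ N.asIdeal ≤ Q.asIdeal

/-- The set of `t`-maximal ideals is independent of finite character. -/
def IsWeaklyMatlis : Prop :=
  Independent (tMax A K) ∧ FiniteCharacter (tMax A K)

variable {A K} in
/-- An overring `T` of `A` is `t`-flat if `T_M = A_{M ∩ A}` for every `t`-maximal ideal `M`
of `T`. -/
def IsTFlat (T : Subalgebra A K) : Prop :=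
  ∀ M ∈ tMax T K,
    (locAt K M : Set K) = (locAt K (PrimeSpectrum.comap (algebraMap A T) M) : Set K)

end Domains

section Fractions

variable {A : Type*} (K : Type*) [CommRing A] [Field K] [Algebra A K]

/-- The multiplicative system `F(Λ)` of the ideals that are contained in no member of `Λ`. -/
def idealSystem (Λ : Set (PrimeSpectrum A)) : Submonoid (Ideal A) where
  carrier := {J | ∀ P ∈ Λ, ¬ J ≤ P.asIdeal}
  one_mem' := fun P _ h => P.2.ne_top (top_le_iff.1 (Ideal.one_eq_top (R := A) ▸ h))
  mul_mem' := fun hI hJ P hP h => (P.2.mul_le.1 h).elim (hI P hP) (hJ P hP)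

/-- The generalized ring of fractions of `A` with respect to a multiplicative system `F` of
ideals: the union in `K` of the `(A : J)`, for `J ∈ F`. -/
def genFractionRing (F : Submonoid (Ideal A)) : Subalgebra A K where
  carrier := {x | ∃ J ∈ F, x ∈ (1 : Submodule A K) / IsLocalization.coeSubmodule K J}
  mul_mem' := by
    rintro x y ⟨I, hI, hx⟩ ⟨J, hJ, hy⟩
    refine ⟨I * J, F.mul_mem hI hJ, ?_⟩
    rw [IsLocalization.coeSubmodule_mul, Submodule.mem_div_iff_forall_mul_mem]
    intro z hz
    refine Submodule.mul_induction_on hz (fun a ha b hb => ?_) (fun a b ha hb => ?_)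
    · have h1 := Submodule.mem_div_iff_forall_mul_mem.1 hx a ha
      have h2 := Submodule.mem_div_iff_forall_mul_mem.1 hy b hb
      have h3 := Submodule.mul_mem_mul h1 h2
      rw [one_mul] at h3
      rwa [mul_mul_mul_comm]
    · rw [mul_add]
      exact Submodule.add_mem _ ha hb
  add_mem' := by
    rintro x y ⟨I, hI, hx⟩ ⟨J, hJ, hy⟩
    refine ⟨I * J, F.mul_mem hI hJ, Submodule.add_mem _ ?_ ?_⟩
    · exact div_anti (IsLocalization.coeSubmodule_mono K Ideal.mul_le_left) 1 hx
    · exact div_anti (IsLocalization.coeSubmodule_mono K Ideal.mul_le_right) 1 hy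
  algebraMap_mem' := by
    intro a
    refine ⟨1, F.one_mem, Submodule.mem_div_iff_forall_mul_mem.2 ?_⟩
    rintro _ ⟨b, _, rfl⟩
    exact Submodule.mem_one.2 ⟨a * b, by simp⟩

end Fractions

end WDiv

end

/-!
Write `T = R_{F(Λ)}`; it is the intersection of the `R_P`, `P ∈ Λ`. For `P ∈ Λ` the prime
`P R_P ∩ T` of `T` (`fracPrime`) satisfies `T_{P R_P ∩ T} = R_P`, a divisorial domain, and is
therefore a `t`-prime of `T`. All five conditions amount to saying that these primes are the
`t`-maximal ideals of `T` and form an independent family of finite character.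

Two facts about an arbitrary domain `A` carry the proof.

* If `A` is weakly Matlis, then `(A : I) A_M = (A_M : I A_M)` for every nonzero fractional ideal
  `I` and every `t`-maximal `M`. If moreover all `A_M` are divisorial, this gives
  `I_v ⊆ ⋂ I A_M = I_w`, so `A` is `w`-divisorial (`IsWeaklyMatlis.isWDivisorial`), and hence a
  `TV`-domain, because `I_w ⊆ I_t`.
* If `A` is a `TV`-domain, duality turns the finite type of the `t`-operation into a compactness
  property: a downward directed family of ideals with a common nonzero element, none of them
  contained in the `t`-maximal ideal `M`, has `v`-closures whose intersection is not contained in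
  `M` (`IsTVDomain.exists_notMem_forall_mem_vClosure`). Applied to the finite intersections of
  `t`-maximal ideals it shows that `t-Max(A)` has finite character. Applied to the ideals `(s, x)`
  with `s ∉ M` it shows that `t-Max(A)` is independent, provided that all `A_M` are divisorial
  (`IsTVDomain.isWeaklyMatlis`).

If `T` is a `TV`-domain, each of its `t`-maximal ideals is the conductor of some `y ∉ T`; since
`y ∉ R_P` for some `P ∈ Λ`, it equals `P R_P ∩ T`. So `T` is weakly Matlis, and the incomparability
of the members of `Λ` transfers independence and finite character to `Λ`. If `T` is `t`-flat and
weakly Matlis, its `t`-maximal ideals contract to `t`-primes of `R`, so its localizations at them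
are divisorial and `T` is `w`-divisorial. If `Λ` is independent of finite character, every `t`-prime
of `T` lies in some `P R_P ∩ T`, from which everything follows.
-/

namespace WDiv

open scoped nonZeroDivisors

open IsLocalization (coeSubmodule)

/-! ### Closures of submodules of the quotient field -/

section Closures

variable {A K : Type*} [CommRing A] [Field K] [Algebra A K]

theorem mem_one_div {I : Submodule A K} {y : K} :
    y ∈ 1 / I ↔ ∀ z ∈ I, y * z ∈ (1 : Submodule A K) :=
  Submodule.mem_div_iff_forall_mul_mem

theorem mem_vClosure {I : Submodule A K} {x : K} :
    x ∈ vClosure I ↔ ∀ y, (∀ z ∈ I, y * z ∈ (1 : Submodule A K)) → x * y ∈ (1 : Submodule A K) :=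
  ⟨fun h y hy => mem_one_div.1 h y (mem_one_div.2 hy),
    fun h => mem_one_div.2 fun y hy => h y (mem_one_div.1 hy)⟩

theorem mul_mem_one {x y : K} (hx : x ∈ (1 : Submodule A K)) (hy : y ∈ (1 : Submodule A K)) :
    x * y ∈ (1 : Submodule A K) := by
  simpa using Submodule.mul_mem_mul hx hy

theorem algebraMap_mem_one (a : A) : algebraMap A K a ∈ (1 : Submodule A K) :=
  Submodule.mem_one.2 ⟨a, rfl⟩

theorem one_mem_one : (1 : K) ∈ (1 : Submodule A K) :=
  Submodule.mem_one.2 ⟨1, map_one _⟩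

theorem mul_mem_of_mem_one (I : Submodule A K) {x y : K} (hx : x ∈ (1 : Submodule A K))
    (hy : y ∈ I) : x * y ∈ I := by
  simpa using Submodule.mul_mem_mul hx hy

theorem le_vClosure (I : Submodule A K) : I ≤ vClosure I := fun x hx =>
  mem_vClosure.2 fun y hy => by rw [mul_comm]; exact hy x hx

theorem one_div_vClosure (I : Submodule A K) : 1 / vClosure I = 1 / I :=
  le_antisymm (div_anti (le_vClosure I) 1) (le_vClosure (1 / I))

theorem vClosure_vClosure (I : Submodule A K) : vClosure (vClosure I) = vClosure I :=
  congrArg (1 / ·) (one_div_vClosure I)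

theorem vClosure_one_div (I : Submodule A K) : vClosure (1 / I) = 1 / I :=
  one_div_vClosure I

theorem one_div_one : (1 : Submodule A K) / 1 = 1 :=
  le_antisymm (fun x hx => by simpa using mem_one_div.1 hx 1 one_mem_one)
    fun _ hx => mem_one_div.2 fun _ hz => mul_mem_one hx hz

theorem vClosure_one : vClosure (1 : Submodule A K) = 1 := by
  rw [vClosure, one_div_one, one_div_one]

theorem le_tClosure (I : Submodule A K) : I ≤ tClosure I := fun x hx =>
  ⟨A ∙ x, Submodule.fg_span_singleton x, (Submodule.span_singleton_le_iff_mem x I).2 hx,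
    le_vClosure _ (Submodule.mem_span_singleton_self x)⟩

theorem tClosure_le_vClosure (I : Submodule A K) : tClosure I ≤ vClosure I :=
  fun _ ⟨_, _, hJI, hx⟩ => vClosure_mono hJI hx

theorem tClosure_mono {I J : Submodule A K} (h : I ≤ J) : tClosure I ≤ tClosure J :=
  fun _ ⟨L, hL, hLI, hx⟩ => ⟨L, hL, hLI.trans h, hx⟩

theorem tClosure_one : tClosure (1 : Submodule A K) = 1 :=
  le_antisymm ((tClosure_le_vClosure 1).trans_eq vClosure_one) (le_tClosure 1)

/-- A finitely generated submodule covered by a directed family lies in a member of it. -/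
theorem exists_le_of_fg_of_directed {ι : Type*} [Nonempty ι] {L : ι → Submodule A K}
    (hL : Directed (· ≤ ·) L) {J : Submodule A K} (hJ : J.FG) (h : ∀ z ∈ J, ∃ i, z ∈ L i) :
    ∃ i, J ≤ L i := by
  classical
  obtain ⟨s, rfl⟩ := hJ
  induction s using Finset.induction_on with
  | empty => exact ⟨Classical.arbitrary ι, by simp⟩
  | insert a s _ ih =>
    have hle : Submodule.span A (s : Set K) ≤ Submodule.span A (↑(insert a s) : Set K) :=
      Submodule.span_mono (by simp)
    obtain ⟨i, hi⟩ := ih fun z hz => h z (hle hz)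
    obtain ⟨j, hj⟩ := h a (Submodule.subset_span (by simp))
    obtain ⟨k, hik, hjk⟩ := hL i j
    refine ⟨k, Submodule.span_le.2 fun z hz => ?_⟩
    rcases Finset.mem_insert.1 (Finset.mem_coe.1 hz) with rfl | hz
    · exact hjk hj
    · exact hik (hi (Submodule.subset_span hz))

/-- The union of a directed family of `v`-closed submodules is `t`-closed. -/
theorem exists_mem_of_mem_tClosure_of_directed {ι : Type*} [Nonempty ι] {L : ι → Submodule A K}
    (hL : Directed (· ≤ ·) L) (hv : ∀ i, vClosure (L i) ≤ L i) {x : K}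
    (hx : x ∈ tClosure (⨆ i, L i)) : ∃ i, x ∈ L i := by
  obtain ⟨J, hJ, hJL, hx⟩ := hx
  obtain ⟨i, hi⟩ := exists_le_of_fg_of_directed hL hJ
    fun z hz => (Submodule.mem_iSup_of_directed L hL).1 (hJL hz)
  exact ⟨i, hv i (vClosure_mono hi hx)⟩

theorem tClosure_tClosure (I : Submodule A K) : tClosure (tClosure I) = tClosure I := by
  refine le_antisymm ?_ (le_tClosure _)
  let L : {J : Submodule A K // J.FG ∧ J ≤ I} → Submodule A K := fun J => vClosure J.1
  have : Nonempty {J : Submodule A K // J.FG ∧ J ≤ I} := ⟨⟨⊥, Submodule.fg_bot, bot_le⟩⟩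
  have hL : Directed (· ≤ ·) L := fun J J' =>
    ⟨⟨J.1 ⊔ J'.1, J.2.1.sup J'.2.1, sup_le J.2.2 J'.2.2⟩,
      vClosure_mono le_sup_left, vClosure_mono le_sup_right⟩
  have hI : tClosure I ≤ ⨆ J, L J := fun x ⟨J, hJ, hJI, hx⟩ =>
    (Submodule.mem_iSup_of_directed L hL).2 ⟨⟨J, hJ, hJI⟩, hx⟩
  intro x hx
  obtain ⟨J, hJ⟩ := exists_mem_of_mem_tClosure_of_directed hL
    (fun J => (vClosure_vClosure J.1).le) (tClosure_mono hI hx)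
  exact ⟨J.1, J.2.1, J.2.2, hJ⟩

/-- If `1 ∈ I_t`, then `x I ⊆ L` already forces `x ∈ L_t`. -/
theorem mem_tClosure_of_one_mem {I L : Submodule A K} (hI : (1 : K) ∈ tClosure I) {x : K}
    (h : ∀ z ∈ I, x * z ∈ L) : x ∈ tClosure L := by
  obtain ⟨J, hJ, hJI, h1⟩ := hI
  refine ⟨J.map (LinearMap.mulLeft A x), hJ.map _, ?_, mem_vClosure.2 fun y hy => ?_⟩
  · rintro _ ⟨z, hz, rfl⟩
    exact h z (hJI hz)
  · have := mem_vClosure.1 h1 (x * y) fun z hz => by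
      rw [mul_comm x, mul_assoc]
      exact hy _ ⟨z, hz, rfl⟩
    rwa [one_mul] at this

/-- The localization `I A_P` of a submodule `I` of the quotient field, described elementwise. -/
def localize (P : PrimeSpectrum A) (I : Submodule A K) : Submodule A K where
  carrier := {x | ∃ s ∉ P.asIdeal, s • x ∈ I}
  zero_mem' := ⟨1, P.2.one_notMem, by simp⟩
  add_mem' := by
    rintro x y ⟨s, hs, hx⟩ ⟨t, ht, hy⟩
    refine ⟨s * t, fun h => (P.2.mem_or_mem h).elim hs ht, ?_⟩
    rw [smul_add, mul_comm s, mul_smul, mul_comm t, mul_smul]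
    exact I.add_mem (I.smul_mem t hx) (I.smul_mem s hy)
  smul_mem' := by
    rintro a x ⟨s, hs, hx⟩
    exact ⟨s, hs, by rw [smul_comm]; exact I.smul_mem a hx⟩

theorem le_localize (P : PrimeSpectrum A) (I : Submodule A K) : I ≤ localize P I :=
  fun x hx => ⟨1, P.2.one_notMem, by simpa using hx⟩

theorem mul_mem_localize {P : PrimeSpectrum A} {I J L : Submodule A K}
    (h : ∀ x ∈ I, ∀ y ∈ J, x * y ∈ L) {x y : K} (hx : x ∈ localize P I) (hy : y ∈ localize P J) :
    x * y ∈ localize P L := by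
  obtain ⟨s, hs, hx⟩ := hx
  obtain ⟨t, ht, hy⟩ := hy
  refine ⟨s * t, fun h => (P.2.mem_or_mem h).elim hs ht, ?_⟩
  rw [← smul_mul_smul_comm]
  exact h _ hx _ hy

end Closures

section Localization

variable {A K : Type*} [CommRing A] [Field K] [Algebra A K] [IsFractionRing A K]

theorem algebraMap_ne_zero_of_notMem {P : PrimeSpectrum A} {s : A} (hs : s ∉ P.asIdeal) :
    algebraMap A K s ≠ 0 := by
  rw [Ne, FaithfulSMul.algebraMap_eq_zero_iff]
  rintro rfl
  exact hs P.asIdeal.zero_mem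

variable [IsDomain A]

theorem mem_locAt {P : PrimeSpectrum A} {x : K} :
    x ∈ locAt K P ↔ x ∈ localize P (1 : Submodule A K) := by
  constructor
  · rintro ⟨a, s, hs, rfl⟩
    refine ⟨s, hs, ?_⟩
    have := algebraMap_ne_zero_of_notMem (K := K) hs
    rw [Algebra.smul_def, mul_left_comm, mul_inv_cancel₀ this, mul_one]
    exact algebraMap_mem_one a
  · rintro ⟨s, hs, h⟩
    obtain ⟨a, ha⟩ := Submodule.mem_one.1 h
    refine ⟨a, s, hs, ?_⟩
    have := algebraMap_ne_zero_of_notMem (K := K) hs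
    rw [ha, Algebra.smul_def]
    field_simp

theorem localize_eq_mul (P : PrimeSpectrum A) (I : Submodule A K) :
    I * Subalgebra.toSubmodule (locAt K P) = localize P I := by
  refine le_antisymm (Submodule.mul_le.2 fun x hx y hy => ?_) ?_
  · obtain ⟨s, hs, h⟩ := mem_locAt.1 hy
    exact ⟨s, hs, by rw [← mul_smul_comm, mul_comm]; exact mul_mem_of_mem_one I h hx⟩
  · rintro x ⟨s, hs, h⟩
    have h0 := algebraMap_ne_zero_of_notMem (K := K) hs
    have h1 : (algebraMap A K s)⁻¹ ∈ Subalgebra.toSubmodule (locAt K P) :=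
      mem_locAt.2 ⟨s, hs, by rw [Algebra.smul_def, mul_inv_cancel₀ h0]; exact one_mem_one⟩
    have h2 := Submodule.mul_mem_mul h h1
    rwa [Algebra.smul_def, mul_right_comm, mul_inv_cancel₀ h0, one_mul] at h2

theorem mem_wClosure {I : Submodule A K} {x : K} :
    x ∈ wClosure I ↔ ∀ M ∈ tMax A K, x ∈ localize M I := by
  simp only [wClosure, Submodule.mem_iInf, localize_eq_mul]

theorem le_wClosure (I : Submodule A K) : I ≤ wClosure I :=
  fun _ hx => mem_wClosure.2 fun M _ => le_localize M I hx

/-! ### Fractional ideals as submodules -/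

theorem isFractional_of_mul_mem_one {I : Submodule A K} {d : K} (hd : d ≠ 0)
    (h : ∀ x ∈ I, d * x ∈ (1 : Submodule A K)) : IsFractional A⁰ I := by
  obtain ⟨a, b, hb, rfl⟩ := IsFractionRing.div_surjective A d
  have hb0 : algebraMap A K b ≠ 0 := IsFractionRing.to_map_ne_zero_of_mem_nonZeroDivisors hb
  have ha : a ≠ 0 := by
    rintro rfl
    simp at hd
  refine ⟨a, mem_nonZeroDivisors_of_ne_zero ha, fun x hx => ?_⟩
  obtain ⟨c, hc⟩ := Submodule.mem_one.1 (h x hx)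
  refine ⟨b * c, ?_⟩
  rw [map_mul, hc, Algebra.smul_def]
  field_simp

theorem isFractional_iff {I : Submodule A K} :
    IsFractional A⁰ I ↔ ∃ d : K, d ≠ 0 ∧ ∀ x ∈ I, d * x ∈ (1 : Submodule A K) := by
  refine ⟨fun ⟨a, ha, h⟩ => ⟨algebraMap A K a,
    IsFractionRing.to_map_ne_zero_of_mem_nonZeroDivisors ha, fun x hx => ?_⟩,
    fun ⟨d, hd, h⟩ => isFractional_of_mul_mem_one hd h⟩
  obtain ⟨c, hc⟩ := h x hx
  rw [← Algebra.smul_def, ← hc]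
  exact algebraMap_mem_one c

theorem _root_.IsFractional.of_le_vClosure {I J : Submodule A K} (hI : IsFractional A⁰ I)
    (hJ : J ≤ vClosure I) : IsFractional A⁰ J := by
  obtain ⟨d, hd, h⟩ := isFractional_iff.1 hI
  exact isFractional_of_mul_mem_one hd fun x hx => by
    rw [mul_comm]; exact mem_vClosure.1 (hJ hx) d h

theorem IsTVDomain.vClosure_le (hA : IsTVDomain A K) {I : Submodule A K} (h0 : I ≠ ⊥)
    (hI : IsFractional A⁰ I) : vClosure I ≤ tClosure I := by
  have hd := (hA ⟨tClosure I, hI.of_le_vClosure (tClosure_le_vClosure I)⟩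
    ⟨FractionalIdeal.coeToSubmodule_ne_bot.1 (ne_bot_of_le_ne_bot h0 (le_tClosure I)),
      tClosure_tClosure I⟩).2
  exact (vClosure_mono (le_tClosure I)).trans hd.le

theorem isWDivisorial_of_vClosure_le
    (h : ∀ I : Submodule A K, I ≠ ⊥ → IsFractional A⁰ I → vClosure I ≤ wClosure I) :
    IsWDivisorial A K := fun I hI =>
  ⟨hI.1, le_antisymm ((h I (FractionalIdeal.coeToSubmodule_ne_bot.2 hI.1) I.2).trans_eq hI.2)
    (le_vClosure _)⟩

end Localization

/-! ### `t`-maximal ideals -/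

section TMax

variable {A K : Type*} [CommRing A] [Field K] [Algebra A K]

theorem coeSubmodule_le_one (J : Ideal A) : coeSubmodule K J ≤ 1 :=
  (IsLocalization.coeSubmodule_mono K le_top).trans_eq (IsLocalization.coeSubmodule_top K)

theorem algebraMap_mem_coeSubmodule {J : Ideal A} {a : A} (ha : a ∈ J) :
    algebraMap A K a ∈ coeSubmodule K J :=
  ⟨a, ha, rfl⟩

theorem forall_mem_coeSubmodule {J : Ideal A} {p : K → Prop} :
    (∀ z ∈ coeSubmodule K J, p z) ↔ ∀ a ∈ J, p (algebraMap A K a) :=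
  ⟨fun h a ha => h _ ⟨a, ha, rfl⟩, by rintro h _ ⟨a, ha, rfl⟩; exact h a ha⟩

theorem isTIdeal_of_mem_tMax {M : PrimeSpectrum A} (hM : M ∈ tMax A K) :
    IsTIdeal K (M.asIdeal : FractionalIdeal A⁰ K) :=
  hM.1.2

theorem tMax_subset_tSpec : tMax A K ⊆ tSpec A K := fun _ hM => isTIdeal_of_mem_tMax hM

theorem tMax_eq_of_le {M N : PrimeSpectrum A} (hM : M ∈ tMax A K) (hN : N ∈ tSpec A K)
    (h : M.asIdeal ≤ N.asIdeal) : M = N :=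
  PrimeSpectrum.ext (le_antisymm h (hM.2 ⟨N.2.ne_top, hN⟩ h))

variable [IsFractionRing A K]

theorem algebraMap_mem_coeSubmodule_iff {J : Ideal A} {a : A} :
    algebraMap A K a ∈ coeSubmodule K J ↔ a ∈ J :=
  ⟨fun ⟨_, hb, h⟩ => IsFractionRing.injective A K h ▸ hb, algebraMap_mem_coeSubmodule⟩

theorem coeSubmodule_ne_bot {J : Ideal A} (hJ : J ≠ ⊥) : coeSubmodule K J ≠ ⊥ := by
  obtain ⟨a, ha, h0⟩ := Submodule.exists_mem_ne_zero_of_ne_bot hJ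
  exact (Submodule.ne_bot_iff _).2 ⟨_, algebraMap_mem_coeSubmodule ha,
    (FaithfulSMul.algebraMap_eq_zero_iff A K).not.2 h0⟩

theorem isTIdeal_coeIdeal {J : Ideal A} :
    IsTIdeal K (J : FractionalIdeal A⁰ K) ↔
      J ≠ ⊥ ∧ tClosure (coeSubmodule K J) ≤ coeSubmodule K J :=
  and_congr FractionalIdeal.coeIdeal_ne_zero
    ⟨fun h => h.le, fun h => le_antisymm h (le_tClosure _)⟩

variable [IsDomain A]

theorem IsTIdeal.one_notMem {J : Ideal A} (hJ : IsTIdeal K (J : FractionalIdeal A⁰ K))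
    (h : J ≠ ⊤) : (1 : K) ∉ tClosure (coeSubmodule K J) := fun h1 =>
  h (J.eq_top_iff_one.2 (algebraMap_mem_coeSubmodule_iff (K := K).1
    (by simpa using (isTIdeal_coeIdeal.1 hJ).2 h1)))

/-- A nonzero ideal whose `t`-closure is proper is contained in a `t`-maximal ideal. -/
theorem exists_le_tMax {J : Ideal A} (hJ : J ≠ ⊥) (h : (1 : K) ∉ tClosure (coeSubmodule K J)) :
    ∃ M ∈ tMax A K, J ≤ M.asIdeal := by
  -- An ideal maximal among those with `1 ∉ I_t` is automatically a `t`-ideal, and prime.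
  obtain ⟨M, hJM, hM⟩ := zorn_le_nonempty₀ {I : Ideal A | (1 : K) ∉ tClosure (coeSubmodule K I)}
    (fun c hc hchain I hI => by
      refine ⟨sSup c, ?_, fun L hL => le_sSup hL⟩
      rintro ⟨L, hL, hLc, h1⟩
      have : Nonempty c := ⟨⟨I, hI⟩⟩
      have hdir : Directed (· ≤ ·) fun I : c => coeSubmodule K I.1 := fun I I' => by
        rcases hchain.total I.2 I'.2 with h | h
        · exact ⟨I', IsLocalization.coeSubmodule_mono K h, le_rfl⟩
        · exact ⟨I, le_rfl, IsLocalization.coeSubmodule_mono K h⟩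
      obtain ⟨⟨I', hI'⟩, hLI'⟩ := exists_le_of_fg_of_directed hdir hL fun z hz => by
        obtain ⟨a, ha, rfl⟩ := hLc hz
        obtain ⟨I', hI', ha⟩ := (Submodule.mem_sSup_of_directed ⟨I, hI⟩ hchain.directedOn).1 ha
        exact ⟨⟨I', hI'⟩, algebraMap_mem_coeSubmodule ha⟩
      exact hc hI' ⟨L, hL, hLI', h1⟩) J h
  have h0 : M ≠ ⊥ := ne_bot_of_le_ne_bot hJ hJM
  have hM1 : (1 : K) ∉ tClosure (coeSubmodule K M) := hM.1
  have hout : ∀ a ∉ M, (1 : K) ∈ tClosure (coeSubmodule K (M ⊔ Ideal.span {a})) := fun a ha => by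
    by_contra h1
    exact ha (hM.2 (y := M ⊔ Ideal.span {a}) h1 le_sup_left
      (Submodule.mem_sup_right (Ideal.mem_span_singleton_self a)))
  have htM : tClosure (coeSubmodule K M) ≤ coeSubmodule K M := by
    have hle : M ≤ (tClosure (coeSubmodule K M)).comap (Algebra.linearMap A K) :=
      fun a ha => le_tClosure _ (algebraMap_mem_coeSubmodule ha)
    have := hM.2 (y := (tClosure (coeSubmodule K M)).comap (Algebra.linearMap A K))
      (fun h1 => hM1 (by
        refine (tClosure_tClosure _).le (tClosure_mono ?_ h1)
        rintro _ ⟨a, ha, rfl⟩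
        exact ha)) hle
    intro x hx
    obtain ⟨a, rfl⟩ := Submodule.mem_one.1
      (tClosure_one.le (tClosure_mono (coeSubmodule_le_one M) hx))
    exact algebraMap_mem_coeSubmodule (this hx)
  have htop : M ≠ ⊤ := by
    rintro rfl
    exact hM1 (by rw [IsLocalization.coeSubmodule_top, tClosure_one]; exact one_mem_one)
  have hprime : M.IsPrime := by
    refine ⟨htop, fun {a b} hab => or_iff_not_imp_left.2 fun ha => ?_⟩
    have : algebraMap A K b ∈ tClosure (coeSubmodule K M) := by
      refine mem_tClosure_of_one_mem (hout a ha) (forall_mem_coeSubmodule.2 fun c hc => ?_)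
      rw [← map_mul, algebraMap_mem_coeSubmodule_iff]
      obtain ⟨m, hm, n, hn, rfl⟩ := Submodule.mem_sup.1 hc
      obtain ⟨d, rfl⟩ := Ideal.mem_span_singleton'.1 hn
      rw [mul_add, mul_left_comm, mul_comm b a]
      exact M.add_mem (M.mul_mem_left b hm) (M.mul_mem_left d hab)
    exact algebraMap_mem_coeSubmodule_iff.1 (htM this)
  refine ⟨⟨M, hprime⟩, ⟨⟨htop, isTIdeal_coeIdeal.2 ⟨h0, htM⟩⟩, fun I hI hMI => ?_⟩, hJM⟩
  exact hM.2 (hI.2.one_notMem hI.1) hMI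

theorem one_mem_tClosure_sup_span {M : PrimeSpectrum A} (hM : M ∈ tMax A K) {s : A}
    (hs : s ∉ M.asIdeal) : (1 : K) ∈ tClosure (coeSubmodule K (M.asIdeal ⊔ Ideal.span {s})) := by
  by_contra h
  obtain ⟨N, hN, hle⟩ := exists_le_tMax
    (ne_bot_of_le_ne_bot (isTIdeal_coeIdeal.1 hM.1.2).1 le_sup_left) h
  have := tMax_eq_of_le hM (tMax_subset_tSpec hN) (le_sup_left.trans hle)
  subst this
  exact hs (hle (Submodule.mem_sup_right (Ideal.mem_span_singleton_self s)))

/-- An element of `(A : M)` that maps some `s ∉ M` into `A` lies in `A`, as `1 ∈ (M + s A)_t`. -/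
theorem mem_one_of_mul_mem_one {M : PrimeSpectrum A} (hM : M ∈ tMax A K) {y : K}
    (hy : ∀ m ∈ M.asIdeal, y * algebraMap A K m ∈ (1 : Submodule A K)) {s : A}
    (hs : s ∉ M.asIdeal) (hys : y * algebraMap A K s ∈ (1 : Submodule A K)) :
    y ∈ (1 : Submodule A K) := by
  refine tClosure_one.le (mem_tClosure_of_one_mem (one_mem_tClosure_sup_span hM hs)
    (forall_mem_coeSubmodule.2 fun c hc => ?_))
  obtain ⟨m, hm, n, hn, rfl⟩ := Submodule.mem_sup.1 hc
  obtain ⟨d, rfl⟩ := Ideal.mem_span_singleton'.1 hn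
  rw [map_add, mul_add, map_mul, mul_left_comm]
  exact Submodule.add_mem _ (hy m hm) (mul_mem_one (algebraMap_mem_one d) hys)

/-- For `x ∈ I_w`, the ideal of all `a` with `a x ∈ I` lies in no `t`-maximal ideal, so its
`t`-closure contains `1`; this gives `x ∈ I_t`. -/
theorem wClosure_le_tClosure {I : Submodule A K} (hI : I ≠ ⊥) : wClosure I ≤ tClosure I := by
  intro x hx
  let J : Ideal A := I.comap (LinearMap.toSpanSingleton A K x)
  have hJ : ∀ a, a ∈ J ↔ a • x ∈ I := fun a => Iff.rfl
  have h0 : J ≠ ⊥ := by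
    obtain ⟨i, hi, hi0⟩ := Submodule.exists_mem_ne_zero_of_ne_bot hI
    obtain ⟨a, b, hb, rfl⟩ := IsFractionRing.div_surjective A x
    obtain ⟨p, q, hq, rfl⟩ := IsFractionRing.div_surjective A i
    have hb0 : algebraMap A K b ≠ 0 := IsFractionRing.to_map_ne_zero_of_mem_nonZeroDivisors hb
    have hq0 : algebraMap A K q ≠ 0 := IsFractionRing.to_map_ne_zero_of_mem_nonZeroDivisors hq
    refine (Submodule.ne_bot_iff _).2 ⟨b * p, (hJ _).2 ?_, ?_⟩
    · convert I.smul_mem (a * q) hi using 1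
      simp only [Algebra.smul_def, map_mul]
      field_simp
    · rintro h
      rcases mul_eq_zero.1 h with rfl | rfl
      · simp at hb0
      · simp at hi0
  have h1 : (1 : K) ∈ tClosure (coeSubmodule K J) := by
    by_contra h1
    obtain ⟨M, hM, hJM⟩ := exists_le_tMax h0 h1
    obtain ⟨s, hs, h⟩ := mem_wClosure.1 hx M hM
    exact hs (hJM h)
  refine mem_tClosure_of_one_mem h1 (forall_mem_coeSubmodule.2 fun a ha => ?_)
  rw [mul_comm, ← Algebra.smul_def]
  exact ha

/-- A domain is the intersection of its localizations at the `t`-maximal ideals. -/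
theorem mem_one_of_forall_mem_localize {x : K}
    (h : ∀ M ∈ tMax A K, x ∈ localize M (1 : Submodule A K)) : x ∈ (1 : Submodule A K) :=
  tClosure_one.le (wClosure_le_tClosure
    ((Submodule.ne_bot_iff _).2 ⟨1, one_mem_one, one_ne_zero⟩) (mem_wClosure.2 h))

theorem IsWDivisorial.isTVDomain (hA : IsWDivisorial A K) : IsTVDomain A K := fun I hI =>
  hA I ⟨hI.1, le_antisymm ((wClosure_le_tClosure
    (FractionalIdeal.coeToSubmodule_ne_bot.2 hI.1)).trans_eq hI.2) (le_wClosure _)⟩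

end TMax

/-! ### Domains in which `t`-ideals are divisorial -/

section TV

variable {A K : Type*} [CommRing A] [IsDomain A] [Field K] [Algebra A K] [IsFractionRing A K]

/-- In a `TV`-domain, `(A : M) ≠ A` for `M` `t`-maximal. -/
theorem IsTVDomain.exists_one_div_tMax (hA : IsTVDomain A K) {M : PrimeSpectrum A}
    (hM : M ∈ tMax A K) : ∃ y : K, (∀ m ∈ M.asIdeal, y * algebraMap A K m ∈ (1 : Submodule A K)) ∧
      y ∉ (1 : Submodule A K) := by
  by_contra! h
  have h1 : (1 : K) ∈ vClosure (coeSubmodule K M.asIdeal) := mem_vClosure.2 fun y hy => by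
    rw [one_mul]
    exact h y fun m hm => hy _ (algebraMap_mem_coeSubmodule hm)
  rw [← FractionalIdeal.coe_coeIdeal (S := A⁰), (hA _ (isTIdeal_of_mem_tMax hM)).2] at h1
  exact (isTIdeal_of_mem_tMax hM).one_notMem M.2.ne_top (le_tClosure _ h1)

/-- A compactness property of `t`-maximal ideals `M`: if no member of a downward directed family
of ideals `D i` is contained in `M`, then neither is the intersection of the `(D i)_v`, provided
that the `D i` have a common nonzero element. Indeed `⋃ (A : D i)` is a `t`-ideal, hence divisorial;
if the intersection were in `M`, this union would contain some `y ∈ (A : M) ∖ A`, and `y` cannot map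
an ideal not contained in `M` into `A`. -/
theorem IsTVDomain.exists_notMem_forall_mem_vClosure (hA : IsTVDomain A K) {M : PrimeSpectrum A}
    (hM : M ∈ tMax A K) {ι : Type*} [Nonempty ι] {D : ι → Ideal A} (hD : Directed (· ≥ ·) D)
    {x : A} (hx0 : x ≠ 0) (hx : ∀ i, x ∈ D i) (hDM : ∀ i, ¬ D i ≤ M.asIdeal) :
    ∃ b ∉ M.asIdeal, ∀ i, algebraMap A K b ∈ vClosure (coeSubmodule K (D i)) := by
  by_contra! hcon
  obtain ⟨y, hyM, hy⟩ := hA.exists_one_div_tMax hM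
  let L : ι → Submodule A K := fun i => 1 / coeSubmodule K (D i)
  have hL : Directed (· ≤ ·) L := fun i j => by
    obtain ⟨k, hki, hkj⟩ := hD i j
    exact ⟨k, div_anti (IsLocalization.coeSubmodule_mono K hki) 1,
      div_anti (IsLocalization.coeSubmodule_mono K hkj) 1⟩
  have h1L : ∀ i, (1 : Submodule A K) ≤ L i := fun i z hz => mem_one_div.2 fun w hw =>
    mul_mem_one hz (coeSubmodule_le_one _ hw)
  have i₀ : ι := Classical.arbitrary ι
  have h1 : (1 : K) ∈ ⨆ i, L i := le_iSup L i₀ (h1L i₀ one_mem_one)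
  have hfrac : IsFractional A⁰ (⨆ i, L i) := by
    refine isFractional_of_mul_mem_one ((FaithfulSMul.algebraMap_eq_zero_iff A K).not.2 hx0) ?_
    intro z hz
    obtain ⟨i, hi⟩ := (Submodule.mem_iSup_of_directed L hL).1 hz
    rw [mul_comm]
    exact mem_one_div.1 hi _ (algebraMap_mem_coeSubmodule (hx i))
  have hyv : y ∈ vClosure (⨆ i, L i) := mem_vClosure.2 fun u hu => by
    obtain ⟨a, rfl⟩ := Submodule.mem_one.1 (by simpa using hu 1 h1)
    refine hyM a ?_
    by_contra ha
    obtain ⟨i, hi⟩ := hcon a ha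
    exact hi (mem_one_div.2 fun z hz => hu z (le_iSup L i hz))
  obtain ⟨i, hi⟩ := exists_mem_of_mem_tClosure_of_directed hL
    (fun i => (vClosure_one_div _).le)
    (hA.vClosure_le ((Submodule.ne_bot_iff _).2 ⟨1, h1, one_ne_zero⟩) hfrac hyv)
  obtain ⟨s, hs, hsM⟩ := SetLike.not_le_iff_exists.1 (hDM i)
  exact hy (mem_one_of_mul_mem_one hM hyM hsM (mem_one_div.1 hi _ (algebraMap_mem_coeSubmodule hs)))

/-- Let `S` be the set of `t`-maximal ideals containing `x ≠ 0`. By compactness each `N ∈ S` omits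
an element common to all other members of `S`, so the elements lying in almost all members of `S`
form an ideal contained in no `t`-maximal ideal; finitely many of them generate `A` up to
`v`-closure, so no member of `S` contains them all, and `S` is finite. -/
theorem IsTVDomain.finiteCharacter_tMax (hA : IsTVDomain A K) : FiniteCharacter (tMax A K) := by
  classical
  intro x hx
  set S : Set (PrimeSpectrum A) := {M ∈ tMax A K | x ∈ M.asIdeal} with hS
  -- Each `N ∈ S` is separated from all the others at once.
  have hsep : ∀ N ∈ S, ∃ b ∉ N.asIdeal, ∀ M ∈ S, M ≠ N → b ∈ M.asIdeal := by
    intro N hN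
    let D : {F : Finset (PrimeSpectrum A) // ∀ M ∈ F, M ∈ S ∧ M ≠ N} → Ideal A :=
      fun F => F.1.inf PrimeSpectrum.asIdeal
    have : Nonempty {F : Finset (PrimeSpectrum A) // ∀ M ∈ F, M ∈ S ∧ M ≠ N} := ⟨⟨∅, by simp⟩⟩
    have hD : Directed (· ≥ ·) D := fun F G => ⟨⟨F.1 ∪ G.1, fun M hM =>
        (Finset.mem_union.1 hM).elim (F.2 M) (G.2 M)⟩,
      Finset.inf_mono Finset.subset_union_left, Finset.inf_mono Finset.subset_union_right⟩
    obtain ⟨b, hbN, hb⟩ := hA.exists_notMem_forall_mem_vClosure hN.1 hD hx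
      (fun F => (Submodule.mem_finsetInf).2 fun M hM => (F.2 M hM).1.2)
      (fun F hF => by
        obtain ⟨M, hM, hMN⟩ := (Ideal.IsPrime.inf_le' N.2).1 hF
        exact (F.2 M hM).2 (tMax_eq_of_le (F.2 M hM).1.1 (tMax_subset_tSpec hN.1) hMN))
    refine ⟨b, hbN, fun M hM hMN => ?_⟩
    have h1 := hb ⟨{M}, by simpa using ⟨hM, hMN⟩⟩
    simp only [D, Finset.inf_singleton] at h1
    rw [← FractionalIdeal.coe_coeIdeal (S := A⁰), (hA _ (isTIdeal_of_mem_tMax hM.1)).2] at h1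
    exact algebraMap_mem_coeSubmodule_iff.1 h1
  -- The elements lying in almost all members of `S` generate `A` as a `t`-ideal.
  let I : Ideal A :=
    { carrier := {a | {M ∈ S | a ∉ M.asIdeal}.Finite}
      zero_mem' := by simp
      add_mem' := fun {a b} ha hb => (ha.union hb).subset fun M ⟨hM, h⟩ => by
        by_contra h'
        simp only [Set.mem_union, Set.mem_ofPred_eq, hM, true_and, not_or, not_not] at h'
        exact h (M.asIdeal.add_mem h'.1 h'.2)
      smul_mem' := fun c a ha => ha.subset fun M ⟨hM, h⟩ =>
        ⟨hM, fun h' => h (M.asIdeal.mul_mem_left c h')⟩ }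
  have hI : ∀ a, a ∈ I ↔ {M ∈ S | a ∉ M.asIdeal}.Finite := fun a => Iff.rfl
  have hxI : x ∈ I := (hI x).2 (Set.finite_empty.subset fun M ⟨hM, h⟩ => h hM.2)
  have h1 : (1 : K) ∈ tClosure (coeSubmodule K I) := by
    by_contra h1
    obtain ⟨N, hN, hIN⟩ := exists_le_tMax ((Submodule.ne_bot_iff _).2 ⟨x, hxI, hx⟩) h1
    obtain ⟨b, hbN, hb⟩ := hsep N ⟨hN, hIN hxI⟩
    refine hbN (hIN ((hI b).2 ((Set.finite_singleton N).subset fun M ⟨hM, h⟩ => ?_)))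
    by_contra hMN
    exact h (hb M hM hMN)
  obtain ⟨J, ⟨s, rfl⟩, hJI, h1⟩ := h1
  have hfin : (⋃ z ∈ s, {M ∈ S | z ∉ coeSubmodule K M.asIdeal}).Finite := by
    refine s.finite_toSet.biUnion fun z hz => ?_
    obtain ⟨a, ha, rfl⟩ := hJI (Submodule.subset_span hz)
    exact ((hI a).1 ha).subset fun M ⟨hM, h⟩ => ⟨hM, fun h' => h (algebraMap_mem_coeSubmodule h')⟩
  refine hfin.subset fun M hM => ?_
  by_contra h
  simp only [Set.mem_iUnion, not_exists, Set.mem_ofPred_eq, not_and, not_not] at h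
  exact (isTIdeal_of_mem_tMax hM.1).one_notMem M.2.ne_top
    ⟨_, ⟨s, rfl⟩, Submodule.span_le.2 fun z hz => h z hz hM, h1⟩

/-- In a `TV`-domain, the `t`-maximal ideals are independent as soon as `J_v ⊆ J A_N` for `J`
finitely generated and `N` `t`-maximal. If `0 ≠ x` lies in a nonzero prime inside `M ∩ N`, then
compactness applied to the ideals `(s, x)`, `s ∉ M`, yields `b ∉ M` lying in all the `(s, x)_v`;
taking `s = b² c` with `c ∈ N ∖ M` forces `b ∈ x A_N`. -/
theorem IsTVDomain.independent_tMax (hA : IsTVDomain A K)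
    (hloc : ∀ N ∈ tMax A K, ∀ J : Submodule A K, J ≠ ⊥ → J.FG → vClosure J ≤ localize N J) :
    Independent (tMax A K) := by
  rintro M hM N hN hMN ⟨P, hP0, hPM, hPN⟩
  obtain ⟨x, hxP, hx0⟩ := Submodule.exists_mem_ne_zero_of_ne_bot hP0
  obtain ⟨c, hcN, hcM⟩ := SetLike.not_le_iff_exists.1 fun h =>
    hMN (tMax_eq_of_le hN (tMax_subset_tSpec hM) h).symm
  let D : {s : A // s ∉ M.asIdeal} → Ideal A := fun s => Ideal.span {s.1, x}
  have : Nonempty {s : A // s ∉ M.asIdeal} := ⟨⟨c, hcM⟩⟩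
  have hD : Directed (· ≥ ·) D := fun s t => by
    refine ⟨⟨s.1 * t.1, fun h => (M.2.mem_or_mem h).elim s.2 t.2⟩, ?_, ?_⟩ <;>
    refine Ideal.span_le.2 ?_ <;> rintro _ (rfl | rfl)
    · exact Ideal.mul_mem_right _ _ (Ideal.subset_span (by simp))
    · exact Ideal.subset_span (by simp)
    · exact Ideal.mul_mem_left _ _ (Ideal.subset_span (by simp))
    · exact Ideal.subset_span (by simp)
  obtain ⟨b, hbM, hb⟩ := hA.exists_notMem_forall_mem_vClosure hM hD hx0
    (fun s => Ideal.subset_span (by simp))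
    (fun s h => s.2 (h (Ideal.subset_span (by simp))))
  have hs : b ^ 2 * c ∉ M.asIdeal := fun h =>
    (M.2.mem_or_mem h).elim (fun h => hbM (M.2.mem_of_pow_mem 2 h)) hcM
  have hne : D ⟨_, hs⟩ ≠ ⊥ := (Submodule.ne_bot_iff _).2 ⟨x, Ideal.subset_span (by simp), hx0⟩
  have hfg : (coeSubmodule K (D ⟨_, hs⟩)).FG :=
    Submodule.FG.map _ (Submodule.fg_span (Set.toFinite _))
  obtain ⟨u, huN, hu⟩ := hloc N hN _ (coeSubmodule_ne_bot hne) hfg (hb ⟨_, hs⟩)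
  rw [Algebra.smul_def, ← map_mul, algebraMap_mem_coeSubmodule_iff] at hu
  obtain ⟨e, f, hef⟩ := Ideal.mem_span_pair.1 hu
  -- `(u - e b c) b = f x ∈ P`, and the first factor is outside `N`, hence outside `P`.
  have hmem : (u - e * b * c) * b ∈ P.asIdeal := by
    have : (u - e * b * c) * b = f * x := by linear_combination -hef
    rw [this]
    exact P.asIdeal.mul_mem_left f hxP
  rcases P.2.mem_or_mem hmem with h | h
  · exact huN ((Submodule.sub_mem_iff_left _ (N.asIdeal.mul_mem_left _ hcN)).1 (hPN h))
  · exact hbM (hPM h)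

end TV

/-! ### Divisorial localizations -/

section Transfer

variable {A B K : Type*} [CommRing A] [IsDomain A] [Field K] [Algebra A K] [IsFractionRing A K]
  [CommRing B] [IsDomain B] [Algebra B K] [IsFractionRing B K]

/-- Being a divisorial domain depends only on the image of the ring in the quotient field. -/
theorem IsDivisorialDomain.congr (hA : IsDivisorialDomain A K)
    (h : ∀ x : K, x ∈ (1 : Submodule A K) ↔ x ∈ (1 : Submodule B K)) :
    IsDivisorialDomain B K := by
  intro I hI0
  let I' : Submodule A K :=
    { (I : Submodule B K).toAddSubmonoid with
      smul_mem' := fun a x hx => by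
        rw [Algebra.smul_def]
        exact mul_mem_of_mem_one (I : Submodule B K) ((h _).1 (algebraMap_mem_one a)) hx }
  have hI' : ∀ x, x ∈ I' ↔ x ∈ (I : Submodule B K) := fun x => Iff.rfl
  obtain ⟨z, hz, hz0⟩ :=
    Submodule.exists_mem_ne_zero_of_ne_bot (FractionalIdeal.coeToSubmodule_ne_bot.2 hI0)
  obtain ⟨d, hd0, hd⟩ := isFractional_iff.1 I.isFractional
  have hfrac : IsFractional A⁰ I' :=
    isFractional_of_mul_mem_one hd0 fun x hx => (h _).2 (hd x hx)
  refine ⟨hI0, le_antisymm (fun x hx => (hI' x).1 ?_) (le_vClosure _)⟩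
  have hdiv := (hA ⟨I', hfrac⟩ (FractionalIdeal.coeToSubmodule_ne_bot.1
    ((Submodule.ne_bot_iff _).2 ⟨z, hz, hz0⟩))).2
  refine hdiv.le (mem_vClosure.2 fun y hy => (h _).2 ?_)
  exact mem_vClosure.1 hx y fun z hz => (h _).1 (hy z hz)

end Transfer

section Divisorial

/-- If no nonzero prime ideal is contained in both `M` and `N`, then `A_M A_N = K`: every nonzero
`e` divides a product `s t` with `s ∉ M` and `t ∉ N`. -/
theorem exists_dvd_mul {A : Type*} [CommRing A] {M N : PrimeSpectrum A}
    (h : ¬ ∃ P : PrimeSpectrum A, P.asIdeal ≠ ⊥ ∧ P.asIdeal ≤ M.asIdeal ∧ P.asIdeal ≤ N.asIdeal)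
    {e : A} (he : e ≠ 0) : ∃ s ∉ M.asIdeal, ∃ t ∉ N.asIdeal, e ∣ s * t := by
  by_contra! hcon
  obtain ⟨P, hP, heP, hdisj⟩ := Ideal.exists_le_prime_disjoint (Ideal.span {e})
    (M.asIdeal.primeCompl ⊔ N.asIdeal.primeCompl) <| Set.disjoint_left.2 fun x hx hx' => by
      obtain ⟨s, hs, t, ht, rfl⟩ := Submonoid.mem_sup.1 hx'
      exact hcon s hs t ht (Ideal.mem_span_singleton.1 hx)
  have hle : ∀ x ∈ P, x ∉ M.asIdeal.primeCompl ⊔ N.asIdeal.primeCompl :=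
    fun x hx hx' => Set.disjoint_left.1 hdisj hx hx'
  refine h ⟨⟨P, hP⟩, (Submodule.ne_bot_iff _).2 ⟨e, heP (Ideal.mem_span_singleton_self e), he⟩,
    fun x hx => ?_, fun x hx => ?_⟩ <;> by_contra hx'
  · exact hle x hx (Submonoid.mem_sup_left hx')
  · exact hle x hx (Submonoid.mem_sup_right hx')

variable {A K : Type*} [CommRing A] [Field K] [Algebra A K]

theorem exists_smul_mem_of_fg {P : PrimeSpectrum A} {J L : Submodule A K} (hJ : J.FG)
    (h : J ≤ localize P L) : ∃ s ∉ P.asIdeal, ∀ z ∈ J, s • z ∈ L := by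
  let F : {s : A // s ∉ P.asIdeal} → Submodule A K := fun s => L.comap (LinearMap.lsmul A K s.1)
  have : Nonempty {s : A // s ∉ P.asIdeal} := ⟨⟨1, P.2.one_notMem⟩⟩
  have hF : Directed (· ≤ ·) F := fun s t =>
    ⟨⟨s.1 * t.1, fun h => (P.2.mem_or_mem h).elim s.2 t.2⟩,
      fun z (hz : s.1 • z ∈ L) => show (s.1 * t.1) • z ∈ L by
        rw [mul_comm, mul_smul]; exact L.smul_mem _ hz,
      fun z (hz : t.1 • z ∈ L) => show (s.1 * t.1) • z ∈ L by
        rw [mul_smul]; exact L.smul_mem _ hz⟩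
  obtain ⟨s, hs⟩ := exists_le_of_fg_of_directed hF hJ fun z hz => by
    obtain ⟨s, hs, h⟩ := h hz
    exact ⟨⟨s, hs⟩, h⟩
  exact ⟨s, s.2, hs⟩

variable [IsDomain A] [IsFractionRing A K]

theorem mem_one_locAt {P : PrimeSpectrum A} {x : K} :
    x ∈ (1 : Submodule (locAt K P) K) ↔ x ∈ localize P (1 : Submodule A K) := by
  rw [← mem_locAt, Submodule.mem_one]
  exact ⟨by rintro ⟨y, rfl⟩; exact y.2, fun h => ⟨⟨x, h⟩, rfl⟩⟩

/-- If `A_P` is divisorial and forming `(A : I)` commutes with localization at `P`, then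
`I_v ⊆ I A_P`. -/
theorem vClosure_le_localize {P : PrimeSpectrum A} (hP : IsDivisorialDomain (locAt K P) K)
    {I : Submodule A K} (h0 : I ≠ ⊥) (hI : IsFractional A⁰ I)
    (h : ∀ y : K, (∀ z ∈ I, y * z ∈ localize P (1 : Submodule A K)) → y ∈ localize P (1 / I)) :
    vClosure I ≤ localize P I := by
  let I' : Submodule (locAt K P) K :=
    { (localize P I).toAddSubmonoid with
      smul_mem' := fun a x hx => by
        rw [Algebra.smul_def]
        exact mul_mem_localize (fun _ h _ h' => mul_mem_of_mem_one I h h') (mem_locAt.1 a.2) hx }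
  obtain ⟨z, hz, hz0⟩ := Submodule.exists_mem_ne_zero_of_ne_bot h0
  obtain ⟨d, hd0, hd⟩ := isFractional_iff.1 hI
  have hfrac : IsFractional (locAt K P)⁰ I' :=
    isFractional_of_mul_mem_one hd0 fun x ⟨s, hs, hx⟩ => mem_one_locAt.2
      ⟨s, hs, by rw [← mul_smul_comm]; exact hd _ hx⟩
  have hdiv := (hP ⟨I', hfrac⟩ (FractionalIdeal.coeToSubmodule_ne_bot.1
    ((Submodule.ne_bot_iff _).2 ⟨z, le_localize P I hz, hz0⟩))).2
  refine fun x hx => hdiv.le (mem_vClosure.2 fun y hy => mem_one_locAt.2 ?_)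
  obtain ⟨s, hs, hsy⟩ := h y fun z hz => mem_one_locAt.1 (hy z (le_localize P I hz))
  refine ⟨s, hs, ?_⟩
  rw [← mul_smul_comm]
  exact mem_vClosure.1 hx _ (mem_one_div.1 hsy)

theorem vClosure_le_localize_of_fg {P : PrimeSpectrum A} (hP : IsDivisorialDomain (locAt K P) K)
    {J : Submodule A K} (h0 : J ≠ ⊥) (hJ : J.FG) : vClosure J ≤ localize P J := by
  refine vClosure_le_localize hP h0 (FractionalIdeal.isFractional_of_fg hJ) fun y hy => ?_
  obtain ⟨s, hs, h⟩ := exists_smul_mem_of_fg (hJ.map (LinearMap.mulLeft A y)) (L := 1) <| by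
    rintro _ ⟨z, hz, rfl⟩
    exact hy z hz
  refine ⟨s, hs, mem_one_div.2 fun z hz => ?_⟩
  rw [smul_mul_assoc]
  exact h _ ⟨z, hz, rfl⟩

/-- In a weakly Matlis domain, forming `(A : I)` commutes with localization at `t`-maximal
ideals. -/
theorem IsWeaklyMatlis.mem_localize_one_div (hA : IsWeaklyMatlis A K) {M : PrimeSpectrum A}
    (hM : M ∈ tMax A K) {I : Submodule A K} (hI : IsFractional A⁰ I) {y : K}
    (hy : ∀ z ∈ I, y * z ∈ localize M (1 : Submodule A K)) : y ∈ localize M (1 / I) := by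
  classical
  rcases eq_or_ne y 0 with rfl | hy0
  · exact Submodule.zero_mem _
  obtain ⟨d, hd0, hd⟩ := isFractional_iff.1 hI
  obtain ⟨e, he, heI⟩ := isFractional_of_mul_mem_one (I := I.map (LinearMap.mulLeft A y))
    (div_ne_zero hd0 hy0) <| by
      rintro _ ⟨z, hz, rfl⟩
      rw [LinearMap.mulLeft_apply, ← mul_assoc, div_mul_cancel₀ _ hy0]
      exact hd z hz
  have he0 : e ≠ 0 := nonZeroDivisors.ne_zero he
  -- `e y I ⊆ A`, so only the finitely many `t`-maximal ideals containing `e` matter; each of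
  -- them other than `M` is dealt with by one factor outside `M`.
  have hex : ∀ N : PrimeSpectrum A, ∃ s ∉ M.asIdeal, N ∈ tMax A K → N ≠ M →
      ∀ z ∈ I, s • (y * z) ∈ localize N (1 : Submodule A K) := fun N => by
    by_cases hN : N ∈ tMax A K ∧ N ≠ M
    · obtain ⟨s, hs, t, ht, k, hk⟩ := exists_dvd_mul (hA.1 hM hN.1 hN.2.symm) he0
      refine ⟨s, hs, fun _ _ z hz => ⟨t, ht, ?_⟩⟩
      obtain ⟨c, hc⟩ := heI _ ⟨z, hz, rfl⟩
      rw [← mul_smul, mul_comm t, hk, mul_comm e, mul_smul]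
      exact Submodule.smul_mem _ _ (Submodule.mem_one.2 ⟨c, hc⟩)
    · exact ⟨1, M.2.one_notMem, fun h h' => absurd ⟨h, h'⟩ hN⟩
  choose s hsM hs using hex
  have hfin := hA.2 e he0
  refine ⟨∏ N ∈ hfin.toFinset, s N, ?_, mem_one_div.2 fun z hz => ?_⟩
  · intro h
    obtain ⟨N, -, hN⟩ := (Ideal.IsPrime.prod_mem_iff (hp := M.2)).1 h
    exact hsM N hN
  rw [smul_mul_assoc]
  refine mem_one_of_forall_mem_localize fun N hN => ?_
  rcases eq_or_ne N M with rfl | hNM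
  · exact Submodule.smul_mem _ _ (hy z hz)
  by_cases heN : e ∈ N.asIdeal
  · rw [← Finset.mul_prod_erase _ s (hfin.mem_toFinset.2 ⟨hN, heN⟩), mul_comm, mul_smul]
    exact Submodule.smul_mem _ _ (hs N hN hNM z hz)
  · obtain ⟨c, hc⟩ := heI _ ⟨z, hz, rfl⟩
    exact Submodule.smul_mem _ _ ⟨e, heN, Submodule.mem_one.2 ⟨c, hc⟩⟩

/-- A weakly Matlis domain whose localizations at the `t`-maximal ideals are divisorial is
`w`-divisorial. -/
theorem IsWeaklyMatlis.isWDivisorial (hA : IsWeaklyMatlis A K)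
    (hloc : ∀ M ∈ tMax A K, IsDivisorialDomain (locAt K M) K) : IsWDivisorial A K :=
  isWDivisorial_of_vClosure_le fun _ h0 hI _ hx => mem_wClosure.2 fun M hM =>
    vClosure_le_localize (hloc M hM) h0 hI (fun _ hy => hA.mem_localize_one_div hM hI hy) hx

/-- A `TV`-domain whose localizations at the `t`-maximal ideals are divisorial is weakly
Matlis. -/
theorem IsTVDomain.isWeaklyMatlis (hA : IsTVDomain A K)
    (hloc : ∀ M ∈ tMax A K, IsDivisorialDomain (locAt K M) K) : IsWeaklyMatlis A K :=
  ⟨hA.independent_tMax fun N hN _ h0 hJ => vClosure_le_localize_of_fg (hloc N hN) h0 hJ,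
    hA.finiteCharacter_tMax⟩

/-- A nonzero prime ideal `P` with `A_P` divisorial is a `t`-prime. -/
theorem mem_tSpec_of_isDivisorialDomain {P : PrimeSpectrum A} (h0 : P.asIdeal ≠ ⊥)
    (hP : IsDivisorialDomain (locAt K P) K) : P ∈ tSpec A K := by
  refine isTIdeal_coeIdeal.2 ⟨h0, fun x hx => ?_⟩
  obtain ⟨a, rfl⟩ := Submodule.mem_one.1
    (tClosure_one.le (tClosure_mono (coeSubmodule_le_one _) hx))
  obtain ⟨J, hJ, hJP, hx⟩ := hx
  obtain ⟨p, hp, hp0⟩ := Submodule.exists_mem_ne_zero_of_ne_bot (coeSubmodule_ne_bot (K := K) h0)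
  -- `J` may be zero, so it is enlarged by a nonzero element of `P`.
  have hJ' : J ⊔ A ∙ p ≠ ⊥ := (Submodule.ne_bot_iff _).2
    ⟨p, Submodule.mem_sup_right (Submodule.mem_span_singleton_self p), hp0⟩
  obtain ⟨s, hs, h⟩ := vClosure_le_localize_of_fg hP hJ' (hJ.sup (Submodule.fg_span_singleton p))
    (vClosure_mono le_sup_left hx)
  have := (sup_le hJP ((Submodule.span_singleton_le_iff_mem p _).2 hp)) h
  rw [Algebra.smul_def, ← map_mul, algebraMap_mem_coeSubmodule_iff] at this
  exact algebraMap_mem_coeSubmodule ((P.2.mem_or_mem this).resolve_left hs)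

end Divisorial

/-! ### Primes of an overring -/

section Overring

variable {R K : Type*} [CommRing R] [Field K] [Algebra R K] {T : Subalgebra R K}

/-- The contraction to `R` of a prime ideal of the overring `T`. -/
abbrev contract (Q : PrimeSpectrum T) : PrimeSpectrum R :=
  PrimeSpectrum.comap (algebraMap R T) Q

theorem mem_one_subalgebra {x : K} : x ∈ (1 : Submodule T K) ↔ x ∈ T := by
  rw [Submodule.mem_one]
  exact ⟨by rintro ⟨y, rfl⟩; exact y.2, fun h => ⟨⟨x, h⟩, rfl⟩⟩

variable [IsDomain R] [IsFractionRing R K]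

theorem contract_ne_bot {Q : PrimeSpectrum T} (hQ : Q.asIdeal ≠ ⊥) :
    (contract Q).asIdeal ≠ ⊥ := by
  obtain ⟨t, ht, ht0⟩ := Submodule.exists_mem_ne_zero_of_ne_bot hQ
  obtain ⟨a, b, hb, hab⟩ := IsFractionRing.div_surjective R (t : K)
  have hb0 : algebraMap R K b ≠ 0 := IsFractionRing.to_map_ne_zero_of_mem_nonZeroDivisors hb
  have ha : algebraMap R T a = algebraMap R T b * t := Subtype.ext <| by
    change algebraMap R K a = algebraMap R K b * t
    rw [← hab]
    field_simp
  refine (Submodule.ne_bot_iff _).2 ⟨a, ?_, ?_⟩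
  · change algebraMap R T a ∈ Q.asIdeal
    rw [ha]
    exact Q.asIdeal.mul_mem_left _ ht
  · rintro rfl
    exact ht0 (Subtype.ext (by rw [← hab]; simp))

/-- If `T ⊆ R_P` and `Q ∩ R ⊆ P`, then `T_Q = R_{Q ∩ R}`. -/
theorem mem_localize_one_iff {P : PrimeSpectrum R} (hT : T ≤ locAt K P) {Q : PrimeSpectrum T}
    (hQ : (contract Q).asIdeal ≤ P.asIdeal) {x : K} :
    x ∈ localize Q (1 : Submodule T K) ↔ x ∈ localize (contract Q) (1 : Submodule R K) := by
  constructor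
  · rintro ⟨s, hs, hsx⟩
    obtain ⟨u, hu, hus⟩ := mem_locAt.1 (hT s.2)
    obtain ⟨a, ha⟩ := Submodule.mem_one.1 hus
    obtain ⟨v, hv, hvx⟩ := mem_locAt.1 (hT (mem_one_subalgebra.1 hsx))
    have ha' : algebraMap R T a = algebraMap R T u * s := Subtype.ext <| by
      change algebraMap R K a = algebraMap R K u * s
      rw [ha, Algebra.smul_def]
    refine ⟨v * a, fun h => ?_, ?_⟩
    · rcases (contract Q).2.mem_or_mem h with h | h
      · exact hv (hQ h)
      · change algebraMap R T a ∈ Q.asIdeal at h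
        rw [ha'] at h
        exact (Q.2.mem_or_mem h).elim (fun h => hu (hQ h)) hs
    · have : (v * a) • x = u • v • s • x := by
        simp only [Algebra.smul_def, map_mul, ha]
        change _ = _ * (_ * ((s : K) * x))
        ring
      rw [this]
      exact Submodule.smul_mem _ _ hvx
  · rintro ⟨s, hs, hsx⟩
    obtain ⟨a, ha⟩ := Submodule.mem_one.1 hsx
    refine ⟨algebraMap R T s, hs, mem_one_subalgebra.2 ?_⟩
    rw [algebraMap_smul, ← ha]
    exact T.algebraMap_mem a

/-- The prime ideal `P R_P ∩ T` of an overring `T ⊆ R_P`. -/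
def overPrime (P : PrimeSpectrum R) (hT : T ≤ locAt K P) : PrimeSpectrum T where
  asIdeal :=
    { carrier := {t | (t : K) ∈ localize P (coeSubmodule K P.asIdeal)}
      zero_mem' := (localize P (coeSubmodule K P.asIdeal)).zero_mem
      add_mem' := fun hx hy => (localize P (coeSubmodule K P.asIdeal)).add_mem hx hy
      smul_mem' := fun c t ht => mul_mem_localize
        (fun _ h _ h' => mul_mem_of_mem_one _ h h') (mem_locAt.1 (hT c.2)) ht }
  isPrime := by
    refine ⟨(Ideal.ne_top_iff_one _).2 ?_, fun {x y} hxy => ?_⟩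
    · rintro ⟨s, hs, h⟩
      change s • (1 : K) ∈ _ at h
      rw [Algebra.smul_def, mul_one, algebraMap_mem_coeSubmodule_iff] at h
      exact hs h
    · obtain ⟨s, hs, h⟩ := hxy
      obtain ⟨u, hu, hx⟩ := mem_locAt.1 (hT x.2)
      obtain ⟨v, hv, hy⟩ := mem_locAt.1 (hT y.2)
      obtain ⟨a, ha⟩ := Submodule.mem_one.1 hx
      obtain ⟨b, hb⟩ := Submodule.mem_one.1 hy
      have hab : s * (a * b) ∈ P.asIdeal := by
        rw [← algebraMap_mem_coeSubmodule_iff (K := K)]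
        convert Submodule.smul_mem _ (u * v) h using 1
        simp only [map_mul, ha, hb, Algebra.smul_def]
        change _ = _ * (_ * ((x : K) * y))
        ring
      rcases P.2.mem_or_mem ((P.2.mem_or_mem hab).resolve_left hs) with h | h
      · exact Or.inl ⟨u, hu, ha ▸ algebraMap_mem_coeSubmodule h⟩
      · exact Or.inr ⟨v, hv, hb ▸ algebraMap_mem_coeSubmodule h⟩

theorem mem_overPrime {P : PrimeSpectrum R} {hT : T ≤ locAt K P} {t : T} :
    t ∈ (overPrime P hT).asIdeal ↔ (t : K) ∈ localize P (coeSubmodule K P.asIdeal) :=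
  Iff.rfl

theorem le_overPrime_iff {P : PrimeSpectrum R} {hT : T ≤ locAt K P} {Q : PrimeSpectrum T} :
    Q.asIdeal ≤ (overPrime P hT).asIdeal ↔ (contract Q).asIdeal ≤ P.asIdeal := by
  refine ⟨fun h r hr => ?_, fun h t ht => ?_⟩
  · obtain ⟨s, hs, h⟩ := mem_overPrime.1 (h hr)
    change s • algebraMap R K r ∈ _ at h
    rw [Algebra.smul_def, ← map_mul, algebraMap_mem_coeSubmodule_iff] at h
    exact (P.2.mem_or_mem h).resolve_left hs
  · obtain ⟨s, hs, hst⟩ := mem_locAt.1 (hT t.2)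
    obtain ⟨r, hr⟩ := Submodule.mem_one.1 hst
    refine mem_overPrime.2 ⟨s, hs, hr ▸ algebraMap_mem_coeSubmodule (h ?_)⟩
    have hr' : algebraMap R T r = algebraMap R T s * t := Subtype.ext <| by
      change algebraMap R K r = algebraMap R K s * t
      rw [hr, Algebra.smul_def]
    change algebraMap R T r ∈ Q.asIdeal
    rw [hr']
    exact Q.asIdeal.mul_mem_left _ ht

theorem contract_overPrime (P : PrimeSpectrum R) (hT : T ≤ locAt K P) :
    contract (overPrime P hT) = P := by
  refine PrimeSpectrum.ext (le_antisymm (le_overPrime_iff.1 le_rfl) fun r hr => ?_)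
  have h : algebraMap R K r ∈ localize P (coeSubmodule K P.asIdeal) :=
    le_localize _ _ (algebraMap_mem_coeSubmodule hr)
  exact mem_overPrime (hT := hT) (t := algebraMap R T r).2 h

theorem IsDivisorialDomain.locAt_overring {P : PrimeSpectrum R} (hT : T ≤ locAt K P)
    {Q : PrimeSpectrum T} (hQ : (contract Q).asIdeal ≤ P.asIdeal)
    (h : IsDivisorialDomain (locAt K (contract Q)) K) : IsDivisorialDomain (locAt K Q) K :=
  h.congr fun x => by rw [mem_one_locAt, mem_one_locAt, mem_localize_one_iff hT hQ]

end Overring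

/-! ### The ring of fractions of a family of primes -/

section Fractions

variable {R K : Type*} [CommRing R] [Field K] [Algebra R K] {Λ : Set (PrimeSpectrum R)}

/-- `R_{F(Λ)}` is the intersection of the localizations `R_P`, `P ∈ Λ`. -/
theorem mem_genFractionRing {x : K} :
    x ∈ genFractionRing K (idealSystem Λ) ↔ ∀ P ∈ Λ, x ∈ localize P (1 : Submodule R K) := by
  constructor
  · rintro ⟨J, hJ, hx⟩ P hP
    obtain ⟨s, hs, hsP⟩ := SetLike.not_le_iff_exists.1 (hJ P hP)
    refine ⟨s, hsP, ?_⟩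
    rw [Algebra.smul_def, mul_comm]
    exact mem_one_div.1 hx _ (algebraMap_mem_coeSubmodule hs)
  · intro h
    refine ⟨(1 : Submodule R K).comap (LinearMap.toSpanSingleton R K x), fun P hP hle => ?_,
      mem_one_div.2 (forall_mem_coeSubmodule.2 fun a ha => ?_)⟩
    · obtain ⟨s, hs, hx⟩ := h P hP
      exact hs (hle hx)
    · rw [mul_comm, ← Algebra.smul_def]
      exact ha

variable [IsDomain R] [IsFractionRing R K]

theorem genFractionRing_le_locAt {P : PrimeSpectrum R} (hP : P ∈ Λ) :
    genFractionRing K (idealSystem Λ) ≤ locAt K P :=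
  fun _ hx => mem_locAt.2 (mem_genFractionRing.1 hx P hP)

variable (K) in
/-- The prime ideal `P R_P ∩ R_{F(Λ)}`, for `P ∈ Λ`. -/
def fracPrime (P : Λ) : PrimeSpectrum (genFractionRing K (idealSystem Λ)) :=
  overPrime P.1 (genFractionRing_le_locAt P.2)

theorem contract_fracPrime (P : Λ) : contract (fracPrime K P) = P.1 :=
  contract_overPrime _ _

theorem le_fracPrime_iff {P : Λ} {Q : PrimeSpectrum (genFractionRing K (idealSystem Λ))} :
    Q.asIdeal ≤ (fracPrime K P).asIdeal ↔ (contract Q).asIdeal ≤ P.1.asIdeal :=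
  le_overPrime_iff

theorem mem_localize_fracPrime_iff {P : Λ} {x : K} :
    x ∈ localize (fracPrime K P) (1 : Submodule (genFractionRing K (idealSystem Λ)) K) ↔
      x ∈ localize P.1 (1 : Submodule R K) := by
  rw [mem_localize_one_iff (genFractionRing_le_locAt P.2) (by rw [contract_fracPrime]),
    contract_fracPrime]

theorem isDivisorialDomain_locAt_fracPrime {P : Λ} (h : IsDivisorialDomain (locAt K P.1) K) :
    IsDivisorialDomain (locAt K (fracPrime K P)) K :=
  h.congr fun x => by rw [mem_one_locAt, mem_one_locAt, mem_localize_fracPrime_iff]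

theorem fracPrime_ne_bot {P : Λ} (h0 : P.1.asIdeal ≠ ⊥) : (fracPrime K P).asIdeal ≠ ⊥ := by
  intro h
  obtain ⟨p, hp, hp0⟩ := Submodule.exists_mem_ne_zero_of_ne_bot h0
  rw [← contract_fracPrime (K := K) P] at hp
  change algebraMap R (genFractionRing K (idealSystem Λ)) p ∈ (fracPrime K P).asIdeal at hp
  rw [h, Ideal.mem_bot, FaithfulSMul.algebraMap_eq_zero_iff] at hp
  exact hp0 hp

theorem fracPrime_mem_tSpec {P : Λ} (h0 : P.1.asIdeal ≠ ⊥)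
    (h : IsDivisorialDomain (locAt K P.1) K) :
    fracPrime K P ∈ tSpec (genFractionRing K (idealSystem Λ)) K :=
  mem_tSpec_of_isDivisorialDomain (fracPrime_ne_bot h0) (isDivisorialDomain_locAt_fracPrime h)

/-- The `t`-primes of `R_{F(Λ)}` contract to `t`-primes of `R`. -/
theorem contract_mem_tSpec {Q : PrimeSpectrum (genFractionRing K (idealSystem Λ))}
    (hQ : Q ∈ tSpec (genFractionRing K (idealSystem Λ)) K) : contract Q ∈ tSpec R K := by
  let T := genFractionRing K (idealSystem Λ)
  obtain ⟨h0, hQt⟩ := isTIdeal_coeIdeal.1 hQ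
  refine isTIdeal_coeIdeal.2 ⟨contract_ne_bot h0, fun x hx => ?_⟩
  obtain ⟨r, rfl⟩ := Submodule.mem_one.1
    (tClosure_one.le (tClosure_mono (coeSubmodule_le_one _) hx))
  obtain ⟨J, hJ, hJQ, hx⟩ := hx
  refine algebraMap_mem_coeSubmodule (K := K) ?_
  change algebraMap R T r ∈ Q.asIdeal
  refine algebraMap_mem_coeSubmodule_iff (K := K).1 (hQt ?_)
  refine ⟨Submodule.span T (J : Set K), ?_, Submodule.span_le.2 fun z hz => ?_,
    mem_vClosure.2 fun y hy => mem_one_subalgebra.2 (mem_genFractionRing.2 fun P hP => ?_)⟩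
  · obtain ⟨s, rfl⟩ := hJ
    exact ⟨s, (Submodule.span_span_of_tower R T (s : Set K)).symm⟩
  · obtain ⟨a, ha, rfl⟩ := hJQ hz
    exact ⟨algebraMap R T a, ha, rfl⟩
  · obtain ⟨s, hs, h⟩ := exists_smul_mem_of_fg (P := P) (hJ.map (LinearMap.mulLeft R y))
      (L := 1) <| by
        rintro _ ⟨z, hz, rfl⟩
        exact mem_genFractionRing.1 (mem_one_subalgebra.1 (hy z (Submodule.subset_span hz))) P hP
    refine ⟨s, hs, ?_⟩
    change s • (algebraMap R K r * y) ∈ _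
    rw [← mul_smul_comm]
    refine mem_vClosure.1 hx _ fun z hz => ?_
    rw [smul_mul_assoc]
    exact h _ ⟨z, hz, rfl⟩

/-- If `R_{F(Λ)}` is a `TV`-domain, each of its `t`-maximal ideals is of the form
`P R_P ∩ R_{F(Λ)}`: it is the conductor of some `y`, and `y ∉ R_P` for some `P ∈ Λ`. -/
theorem IsTVDomain.exists_eq_fracPrime (hT : IsTVDomain (genFractionRing K (idealSystem Λ)) K)
    (ht : ∀ P : Λ, fracPrime K P ∈ tSpec (genFractionRing K (idealSystem Λ)) K)
    {M : PrimeSpectrum (genFractionRing K (idealSystem Λ))}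
    (hM : M ∈ tMax (genFractionRing K (idealSystem Λ)) K) : ∃ P : Λ, M = fracPrime K P := by
  obtain ⟨y, hyM, hy⟩ := hT.exists_one_div_tMax hM
  rw [mem_one_subalgebra, mem_genFractionRing] at hy
  push Not at hy
  obtain ⟨P, hP, hy⟩ := hy
  refine ⟨⟨P, hP⟩, tMax_eq_of_le hM (ht _) fun m hm => ?_⟩
  by_contra hmP
  refine hy (mem_localize_fracPrime_iff (P := ⟨P, hP⟩).1 ⟨m, hmP, ?_⟩)
  rw [Algebra.smul_def, mul_comm]
  exact hyM m hm

/-- If `R_{F(Λ)}` is a `TV`-domain with independent `t`-maximal ideals, then `Λ`, being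
pairwise incomparable, is in bijection with them and inherits their properties. -/
theorem independent_and_finiteCharacter_of_isWeaklyMatlis
    (hT : IsTVDomain (genFractionRing K (idealSystem Λ)) K)
    (hW : IsWeaklyMatlis (genFractionRing K (idealSystem Λ)) K)
    (ht : ∀ P : Λ, fracPrime K P ∈ tSpec (genFractionRing K (idealSystem Λ)) K)
    (hinc : ∀ P ∈ Λ, ∀ Q ∈ Λ, P.asIdeal ≤ Q.asIdeal → P = Q) :
    Independent Λ ∧ FiniteCharacter Λ := by
  have hmax : ∀ P : Λ, fracPrime K P ∈ tMax (genFractionRing K (idealSystem Λ)) K := by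
    intro P
    obtain ⟨M, hM, hPM⟩ := exists_le_tMax (isTIdeal_coeIdeal.1 (ht P)).1
      ((ht P).one_notMem (fracPrime K P).2.ne_top)
    obtain ⟨Q, rfl⟩ := hT.exists_eq_fracPrime ht hM
    rw [le_fracPrime_iff, contract_fracPrime] at hPM
    obtain rfl := Subtype.ext (hinc _ P.2 _ Q.2 hPM)
    exact hM
  refine ⟨fun P hP Q hQ hPQ ⟨N, hN0, hNP, hNQ⟩ => ?_, fun x hx => ?_⟩
  · have hne : fracPrime K ⟨P, hP⟩ ≠ fracPrime K ⟨Q, hQ⟩ := fun h => hPQ <| by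
      have := congrArg contract h
      rwa [contract_fracPrime, contract_fracPrime] at this
    -- A nonzero prime `N ⊆ P ∩ Q` of `R` gives the prime `N R_N ∩ T` below both primes of `T`.
    have hN : genFractionRing K (idealSystem Λ) ≤ locAt K N :=
      (genFractionRing_le_locAt hP).trans fun y hy => by
        obtain ⟨s, hs, h⟩ := mem_locAt.1 hy
        exact mem_locAt.2 ⟨s, fun h' => hs (hNP h'), h⟩
    have hcN := contract_overPrime N hN
    refine hW.1 (hmax _) (hmax _) hne ⟨overPrime N hN, fun h => ?_,
      le_fracPrime_iff.2 (by rwa [hcN]), le_fracPrime_iff.2 (by rwa [hcN])⟩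
    obtain ⟨p, hp, hp0⟩ := Submodule.exists_mem_ne_zero_of_ne_bot hN0
    rw [← hcN] at hp
    change algebraMap R (genFractionRing K (idealSystem Λ)) p ∈ (overPrime N hN).asIdeal at hp
    rw [h, Ideal.mem_bot, FaithfulSMul.algebraMap_eq_zero_iff] at hp
    exact hp0 hp
  · have hx' : algebraMap R (genFractionRing K (idealSystem Λ)) x ≠ 0 :=
      (FaithfulSMul.algebraMap_eq_zero_iff _ _).not.2 hx
    refine ((hW.2 _ hx').image contract).subset fun P ⟨hP, hxP⟩ =>
      ⟨fracPrime K ⟨P, hP⟩, ⟨hmax _, ?_⟩, contract_fracPrime ⟨P, hP⟩⟩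
    have hxP' : x ∈ (contract (fracPrime K ⟨P, hP⟩)).asIdeal := by rwa [contract_fracPrime]
    exact hxP'

/-- If `Λ` is of finite character, every `t`-prime of `R_{F(Λ)}` lies over a prime contained in
a member of `Λ`. -/
theorem FiniteCharacter.exists_contract_le (hΛ : FiniteCharacter Λ)
    {Q : PrimeSpectrum (genFractionRing K (idealSystem Λ))}
    (hQ : Q ∈ tSpec (genFractionRing K (idealSystem Λ)) K) :
    ∃ P : Λ, (contract Q).asIdeal ≤ P.1.asIdeal := by
  let T := genFractionRing K (idealSystem Λ)
  by_contra! hcon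
  obtain ⟨a, ha, ha0⟩ := Submodule.exists_mem_ne_zero_of_ne_bot
    (contract_ne_bot (isTIdeal_coeIdeal.1 hQ).1)
  choose b hbQ hbP using fun P : Λ => SetLike.not_le_iff_exists.1 (hcon P)
  have hfin : {P : Λ | a ∈ P.1.asIdeal}.Finite :=
    Set.Finite.of_finite_image ((hΛ a ha0).subset (by
      rintro _ ⟨P, hP, rfl⟩
      exact ⟨P.2, hP⟩)) Subtype.val_injective.injOn
  -- No member of `Λ` contains the finite set `F ⊆ Q ∩ R`.
  set F : Set R := insert a (b '' {P : Λ | a ∈ P.1.asIdeal}) with hF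
  have hFQ : ∀ c ∈ F, c ∈ (contract Q).asIdeal := by
    rintro _ (rfl | ⟨P, -, rfl⟩)
    exacts [ha, hbQ P]
  have hFP : ∀ P : Λ, ∃ c ∈ F, c ∉ P.1.asIdeal := fun P => by
    by_cases h : a ∈ P.1.asIdeal
    · exact ⟨b P, Or.inr ⟨P, h, rfl⟩, hbP P⟩
    · exact ⟨a, Or.inl rfl, h⟩
  refine hQ.one_notMem Q.2.ne_top ⟨Submodule.span T (algebraMap R K '' F),
    Submodule.fg_span (((hfin.image b).insert a).image _), Submodule.span_le.2 ?_,
    mem_vClosure.2 fun y hy => ?_⟩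
  · rintro _ ⟨c, hc, rfl⟩
    exact ⟨algebraMap R T c, hFQ c hc, rfl⟩
  · rw [one_mul, mem_one_subalgebra, mem_genFractionRing]
    intro P hP
    obtain ⟨c, hcF, hcP⟩ := hFP ⟨P, hP⟩
    obtain ⟨s, hs, h⟩ := mem_genFractionRing.1
      (mem_one_subalgebra.1 (hy _ (Submodule.subset_span ⟨c, hcF, rfl⟩))) P hP
    refine ⟨s * c, fun h => (P.2.mem_or_mem h).elim hs hcP, ?_⟩
    rwa [mul_smul, Algebra.smul_def c, mul_comm _ y]

theorem FiniteCharacter.exists_eq_fracPrime (hΛ : FiniteCharacter Λ)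
    (ht : ∀ P : Λ, fracPrime K P ∈ tSpec (genFractionRing K (idealSystem Λ)) K)
    {M : PrimeSpectrum (genFractionRing K (idealSystem Λ))}
    (hM : M ∈ tMax (genFractionRing K (idealSystem Λ)) K) : ∃ P : Λ, M = fracPrime K P := by
  obtain ⟨P, hP⟩ := hΛ.exists_contract_le (tMax_subset_tSpec hM)
  exact ⟨P, tMax_eq_of_le hM (ht P) (le_fracPrime_iff.2 hP)⟩

theorem isWeaklyMatlis_genFractionRing (hind : Independent Λ) (hΛ : FiniteCharacter Λ)
    (ht : ∀ P : Λ, fracPrime K P ∈ tSpec (genFractionRing K (idealSystem Λ)) K) :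
    IsWeaklyMatlis (genFractionRing K (idealSystem Λ)) K := by
  refine ⟨fun M hM N hN hMN ⟨Q, hQ0, hQM, hQN⟩ => ?_, fun t ht0 => ?_⟩
  · obtain ⟨P, rfl⟩ := hΛ.exists_eq_fracPrime ht hM
    obtain ⟨P', rfl⟩ := hΛ.exists_eq_fracPrime ht hN
    refine hind P.2 P'.2 (fun h => hMN (by rw [Subtype.ext h])) ⟨contract Q, contract_ne_bot hQ0,
      le_fracPrime_iff.1 hQM, le_fracPrime_iff.1 hQN⟩
  · obtain ⟨r, s, hs, hrs⟩ := IsFractionRing.div_surjective R (t : K)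
    have hs0 : algebraMap R K s ≠ 0 := IsFractionRing.to_map_ne_zero_of_mem_nonZeroDivisors hs
    have hr : algebraMap R (genFractionRing K (idealSystem Λ)) r = algebraMap R _ s * t :=
      Subtype.ext <| by
        change algebraMap R K r = algebraMap R K s * t
        rw [← hrs]
        field_simp
    have hr0 : r ≠ 0 := by
      rintro rfl
      exact ht0 (Subtype.ext (by rw [← hrs]; simp))
    refine Set.Finite.of_finite_image (f := contract) ((hΛ r hr0).subset ?_) ?_
    · rintro _ ⟨M, ⟨hM, htM⟩, rfl⟩
      have hrM : r ∈ (contract M).asIdeal := by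
        change algebraMap R _ r ∈ M.asIdeal
        rw [hr]
        exact M.asIdeal.mul_mem_left _ htM
      obtain ⟨P, rfl⟩ := hΛ.exists_eq_fracPrime ht hM
      rw [contract_fracPrime] at hrM ⊢
      exact ⟨P.2, hrM⟩
    · rintro M ⟨hM, -⟩ N ⟨hN, -⟩ h
      obtain ⟨P, rfl⟩ := hΛ.exists_eq_fracPrime ht hM
      obtain ⟨P', rfl⟩ := hΛ.exists_eq_fracPrime ht hN
      rw [contract_fracPrime, contract_fracPrime] at h
      rw [Subtype.ext h]

theorem FiniteCharacter.isTFlat (hΛ : FiniteCharacter Λ)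
    (ht : ∀ P : Λ, fracPrime K P ∈ tSpec (genFractionRing K (idealSystem Λ)) K) :
    IsTFlat (genFractionRing K (idealSystem Λ)) := fun M hM => by
  obtain ⟨P, rfl⟩ := hΛ.exists_eq_fracPrime ht hM
  refine Set.ext fun x => ?_
  rw [SetLike.mem_coe, SetLike.mem_coe, mem_locAt, mem_locAt]
  exact mem_localize_one_iff (genFractionRing_le_locAt P.2) (contract_fracPrime P).le

/-- A `t`-flat, weakly Matlis ring `R_{F(Λ)}` is `w`-divisorial if the localizations of `R` at its
`t`-primes are divisorial. -/
theorem isWDivisorial_of_isTFlat (hR : ∀ P ∈ tSpec R K, IsDivisorialDomain (locAt K P) K)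
    (hflat : IsTFlat (genFractionRing K (idealSystem Λ)))
    (hW : IsWeaklyMatlis (genFractionRing K (idealSystem Λ)) K) :
    IsWDivisorial (genFractionRing K (idealSystem Λ)) K :=
  hW.isWDivisorial fun M hM =>
    (hR _ (contract_mem_tSpec (tMax_subset_tSpec hM))).congr fun x => by
      rw [mem_one_locAt, mem_one_locAt, ← mem_locAt, ← mem_locAt, ← SetLike.mem_coe,
        ← SetLike.mem_coe, hflat M hM]

end Fractions

end WDiv

theorem mainTheorem3 {R K : Type*} [CommRing R] [IsDomain R] [Field K] [Algebra R K]
    [IsFractionRing R K] (hR : WDiv.IsStronglyWDivisorial R K)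
    (Λ : Set (PrimeSpectrum R)) (hne : Λ.Nonempty) (hΛ : Λ ⊆ WDiv.tSpec R K)
    (hinc : ∀ P ∈ Λ, ∀ Q ∈ Λ, P.asIdeal ≤ Q.asIdeal → P = Q) :
    List.TFAE [
      WDiv.IsWDivisorial (WDiv.genFractionRing K (WDiv.idealSystem Λ)) K,
      WDiv.IsStronglyWDivisorial (WDiv.genFractionRing K (WDiv.idealSystem Λ)) K,
      WDiv.IsTFlat (WDiv.genFractionRing K (WDiv.idealSystem Λ)) ∧
        WDiv.IsWeaklyMatlis (WDiv.genFractionRing K (WDiv.idealSystem Λ)) K,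
      WDiv.IsTFlat (WDiv.genFractionRing K (WDiv.idealSystem Λ)) ∧
        WDiv.IsTVDomain (WDiv.genFractionRing K (WDiv.idealSystem Λ)) K,
      WDiv.Independent Λ ∧ WDiv.FiniteCharacter Λ] := by
  have hdiv : ∀ P : Λ, WDiv.IsDivisorialDomain (WDiv.locAt K P.1) K := fun P => hR.2 _ (hΛ P.2)
  have ht : ∀ P : Λ, WDiv.fracPrime K P ∈
      WDiv.tSpec (WDiv.genFractionRing K (WDiv.idealSystem Λ)) K := fun P =>
    WDiv.fracPrime_mem_tSpec (WDiv.isTIdeal_coeIdeal.1 (hΛ P.2)).1 (hdiv P)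
  have hTV : WDiv.IsTVDomain (WDiv.genFractionRing K (WDiv.idealSystem Λ)) K →
      WDiv.Independent Λ ∧ WDiv.FiniteCharacter Λ := fun h =>
    WDiv.independent_and_finiteCharacter_of_isWeaklyMatlis h (h.isWeaklyMatlis fun M hM => by
      obtain ⟨P, rfl⟩ := h.exists_eq_fracPrime ht hM
      exact WDiv.isDivisorialDomain_locAt_fracPrime (hdiv P)) ht hinc
  tfae_have 2 → 1 := fun h => h.1
  tfae_have 1 → 5 := fun h => hTV h.isTVDomain
  tfae_have 4 → 5 := fun h => hTV h.2
  tfae_have 3 → 1 := fun h => WDiv.isWDivisorial_of_isTFlat hR.2 h.1 h.2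
  tfae_have 5 → 3 := fun h => ⟨h.2.isTFlat ht, WDiv.isWeaklyMatlis_genFractionRing h.1 h.2 ht⟩
  tfae_have 5 → 4 := fun h => ⟨h.2.isTFlat ht, (WDiv.isWDivisorial_of_isTFlat hR.2
    (h.2.isTFlat ht) (WDiv.isWeaklyMatlis_genFractionRing h.1 h.2 ht)).isTVDomain⟩
  tfae_have 5 → 2 := fun h => ⟨WDiv.isWDivisorial_of_isTFlat hR.2 (h.2.isTFlat ht)
    (WDiv.isWeaklyMatlis_genFractionRing h.1 h.2 ht), fun Q hQ => by
      obtain ⟨P, hP⟩ := h.2.exists_contract_le hQ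
      exact (hR.2 _ (WDiv.contract_mem_tSpec hQ)).locAt_overring
        (WDiv.genFractionRing_le_locAt P.2) hP⟩
  tfae_finish
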